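/- Let $q\ge 1$ and let $\chi$ be a primitive Dirichlet character modulo $q$. Put $$S_\chi=\max_{0\le M<N\le q}\Bigl|\sum_{n=M}^{N}\chi(n)\Bigr|,$$ let $\gamma$ be the Euler constant, let $C_0=4\pi^{5/2}+5$, and define $$\psi_1(q)=1+\frac{24}{\pi^2C_0}+\frac{8}{\pi^2}\,\frac{\sqrt q}{\exp\left(\frac{2\sqrt q}{C_0}\right)-1},\qquad \psi_2(q)=1+\frac{3}{C_0}+\frac{2}{\pi}\,\frac{\sqrt q}{\exp\left(\frac{\pi\sqrt q}{C_0}\right)-1}.$$ 1. If $\chi(-1)=1$, then $$S_\chi\le\frac{2}{\pi^2}\sqrt q\log q+\frac{4}{\pi^2}\sqrt q\,(1+\gamma+\log C_0)+\psi_1(q).$$ 2. If $\chi(-1)=-1$, then $$S_\chi\le\frac{1}{2\pi}\sqrt q\log q+\frac{1}{\pi}\sqrt q\left(1+\gamma+\log\frac{2C_0}{\pi}\right)+\psi_2(q).$$ -/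

import Mathlib

/-- The pairs `(M, N)` of integers with `0 ≤ M < N ≤ q`. -/
def charSumRanges (q : ℕ) : Finset (ℕ × ℕ) :=
  (Finset.range (q + 1) ×ˢ Finset.range (q + 1)).filter (fun p => p.1 < p.2)

theorem charSumRanges_nonempty (q : ℕ) [NeZero q] : (charSumRanges q).Nonempty :=
  ⟨(0, q), by
    have := Nat.pos_of_ne_zero (NeZero.ne q)
    simp [charSumRanges, this]⟩

/-- `S_χ`, the maximum over `0 ≤ M < N ≤ q` of `|∑_{n = M}^{N} χ(n)|` (both ends included). -/
noncomputable def maxCharSum {q : ℕ} [NeZero q] (χ : DirichletCharacter ℂ q) : ℝ :=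
  (charSumRanges q).sup' (charSumRanges_nonempty q)
    (fun p => ‖∑ n ∈ Finset.Icc p.1 p.2, χ (n : ZMod q)‖)

/-- The constant `C₀ = 4 π^{5/2} + 5`. -/
noncomputable def C₀ : ℝ := 4 * Real.pi ^ (5 / 2 : ℝ) + 5

/-- The error term in the bound for even characters. -/
noncomputable def ψ₁ (q : ℕ) : ℝ :=
  1 + 24 / (Real.pi ^ 2 * C₀)
    + 8 / Real.pi ^ 2 * (Real.sqrt q / (Real.exp (2 * Real.sqrt q / C₀) - 1))

/-- The error term in the bound for odd characters. -/
noncomputable def ψ₂ (q : ℕ) : ℝ :=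
  1 + 3 / C₀
    + 2 / Real.pi * (Real.sqrt q / (Real.exp (Real.pi * Real.sqrt q / C₀) - 1))

/-! The proof is a smoothed Pólya–Vinogradov argument. Convolving `χ` with the sawtooth `n mod q`
gives `sawtoothSum`; up to the factor `q`, character sums are its differences, and it moves by at
most `q` per unit step. Averaging over `h` consecutive shifts therefore costs only `h / 2`
(`norm_sum_Icc_le_of_cosineSumDiff`). The averaged sawtooth is a difference of quadratic Bernoulli
functions, so its Fourier series is absolutely convergent, with coefficients of size `1 / k ^ 2`.
For primitive `χ` the `k`-th term is evaluated by the Gauss sum, of modulus `√q`, and carries `|sin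
(k π h / q)|` times a factor `u k` in `[0, 1]`.

With `t = π h / q` and a cutoff `R ≥ 1 / t`, the bound `|sin (k t)| ≤ k t` below `R` and the trivial
bound above it reduce everything to `∑ (1/k - 1/R) u k` over `k ≤ R`, plus bounded terms. The
leading constant is the mean of `u`: `2 / π` for `|sin|` (even `χ`), `1 / 2` for a product of two
sines (odd `χ`). That the mean governs the sum uniformly in the angles follows from Fejér
positivity: the weights have cosine transform at least `-3/4`, and all nonconstant Fourier
coefficients of `|sin|` and `sin ^ 2` are negative.

This gives the stated leading terms. The constant `C₀` is so large that its logarithm absorbs the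
secondary terms, and of `ψ₁`, `ψ₂` only the summand `1` is needed. -/

/-! ### Fejér positivity and the weights `1/k - 1/R`. -/

/-- Positivity of the Fejér kernel, in cumulative form. -/
theorem two_mul_sum_dirichlet_eq (θ : ℝ) (J : ℕ) :
    2 * ∑ j ∈ Finset.range J, (1 / 2 + ∑ k ∈ Finset.range j, Real.cos ((k + 1 : ℕ) * θ)) =
      (∑ j ∈ Finset.range J, Real.cos (j * θ)) ^ 2 +
        (∑ j ∈ Finset.range J, Real.sin (j * θ)) ^ 2 := by
  induction J with
  | zero => simp
  | succ J ih =>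
    have key : ∑ k ∈ Finset.range J, Real.cos ((k + 1 : ℕ) * θ) =
        Real.cos (J * θ) * ∑ j ∈ Finset.range J, Real.cos (j * θ) +
          Real.sin (J * θ) * ∑ j ∈ Finset.range J, Real.sin (j * θ) := by
      rw [← Finset.sum_range_reflect, Finset.mul_sum, Finset.mul_sum, ← Finset.sum_add_distrib]
      refine Finset.sum_congr rfl fun j hj => ?_
      rw [← Real.cos_sub]
      have hj' := Finset.mem_range.1 hj
      have : ((J - 1 - j + 1 : ℕ) : ℝ) = J - j := by
        rw [show J - 1 - j + 1 = J - j by omega, Nat.cast_sub hj'.le]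
      rw [this, sub_mul]
    rw [Finset.sum_range_succ, mul_add, ih, Finset.sum_range_succ (fun j : ℕ => Real.cos (j * θ)),
      Finset.sum_range_succ (fun j : ℕ => Real.sin (j * θ)), key]
    linear_combination -Real.sin_sq_add_cos_sq (J * θ)

theorem sum_dirichlet_nonneg (θ : ℝ) (J : ℕ) :
    0 ≤ ∑ j ∈ Finset.range J, (1 / 2 + ∑ k ∈ Finset.range j, Real.cos ((k + 1 : ℕ) * θ)) := by
  have := two_mul_sum_dirichlet_eq θ J
  nlinarith [sq_nonneg (∑ j ∈ Finset.range J, Real.cos (j * θ)),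
    sq_nonneg (∑ j ∈ Finset.range J, Real.sin (j * θ))]

/-- Abel summation: consecutive weights differ by `1 / ((j + 1) (j + 2))`, and the last weight is
zero, so no boundary term appears. -/
theorem sum_truncated_inv_mul_eq (c : ℕ → ℝ) (n : ℕ) :
    ∑ k ∈ Finset.range (n + 1), (1 / ((k + 1 : ℕ) : ℝ) - 1 / ((n + 1 : ℕ) : ℝ)) * c k =
      ∑ j ∈ Finset.range n, (∑ k ∈ Finset.range (j + 1), c k) / ((j + 1) * (j + 2)) := by
  induction n with
  | zero => simp
  | succ n ih =>
    rw [Finset.sum_range_succ _ n, ← ih, Finset.sum_range_succ _ (n + 1), sub_self, zero_mul,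
      add_zero, Finset.sum_div, ← Finset.sum_add_distrib]
    refine Finset.sum_congr rfl fun k _ => ?_
    push_cast
    field_simp
    ring

/-- The weights `1/k - 1/R`, `1 ≤ k ≤ R`, have a cosine transform bounded below by `-3/4`. -/
theorem neg_three_quarters_le_sum_mul_cos (θ : ℝ) (n : ℕ) :
    -(3 / 4) ≤ ∑ k ∈ Finset.range (n + 1),
      (1 / ((k + 1 : ℕ) : ℝ) - 1 / ((n + 1 : ℕ) : ℝ)) * Real.cos ((k + 1 : ℕ) * θ) := by
  rw [sum_truncated_inv_mul_eq]
  set F : ℕ → ℝ := fun J =>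
    ∑ j ∈ Finset.range J, (1 / 2 + ∑ k ∈ Finset.range j, Real.cos ((k + 1 : ℕ) * θ)) with hF
  have hF0 : ∀ J, 0 ≤ F J := sum_dirichlet_nonneg θ
  have hstep : ∀ j, ∑ k ∈ Finset.range (j + 1), Real.cos ((k + 1 : ℕ) * θ) =
      F (j + 2) - F (j + 1) - 1 / 2 := by
    intro j
    simp only [hF]
    rw [Finset.sum_range_succ _ (j + 1)]
    ring
  -- A second Abel summation. The `-1/4` is the boundary term `F 1 / 2`; the `1/2` in each Dirichlet
  -- kernel telescopes to the remaining loss, which stays below `1/2`.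
  have hind : ∀ n : ℕ, F (n + 1) / ((n + 1) * (n + 2)) - 1 / 4 - 1 / 2 * (1 - 1 / (n + 1)) ≤
      ∑ j ∈ Finset.range n,
        (∑ k ∈ Finset.range (j + 1), Real.cos ((k + 1 : ℕ) * θ)) / ((j + 1) * (j + 2)) := by
    intro n
    induction n with
    | zero => simp [hF]; norm_num
    | succ n ih =>
      rw [Finset.sum_range_succ, hstep n]
      refine le_trans ?_ (add_le_add_left ih _)
      -- Only here is positivity of `F` used during the induction: lowering the coefficient of `F (n
      -- + 2)` to its value at the next stage loses a nonnegative amount.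
      have h1 : F (n + 2) / (((n + 1 : ℕ) + 1 : ℝ) * ((n + 1 : ℕ) + 2)) ≤
          F (n + 2) / ((n + 1) * (n + 2)) := by
        apply div_le_div_of_nonneg_left (hF0 _) (by positivity)
        push_cast
        nlinarith [(Nat.cast_nonneg n : (0 : ℝ) ≤ n)]
      have h2 : (F (n + 2) - F (n + 1) - 1 / 2) / ((n + 1 : ℝ) * (n + 2)) =
          F (n + 2) / ((n + 1) * (n + 2)) - F (n + 1) / ((n + 1) * (n + 2)) -
            1 / 2 * (1 / (n + 1) - 1 / (n + 2)) := by
        field_simp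
        ring
      rw [h2]
      have h3 : (((n + 1 : ℕ) : ℝ) + 1) = n + 2 := by push_cast; ring
      rw [show n + 1 + 1 = n + 2 from rfl]
      rw [h3] at h1 ⊢
      linarith
  refine le_trans ?_ (hind n)
  have h1 : 0 ≤ F (n + 1) / ((n + 1) * (n + 2)) := div_nonneg (hF0 _) (by positivity)
  have h2 : 0 ≤ 1 / ((n : ℝ) + 1) := by positivity
  linarith

/-! ### Fourier series of `|sin|` and weighted sine sums. -/

theorem integral_exp_mul_sin (n : ℤ) :
    ∫ x in (0 : ℝ)..Real.pi, Complex.exp (-(2 * n * x) * Complex.I) * (Real.sin x : ℂ) =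
      2 / (1 - 4 * (n : ℂ) ^ 2) := by
  have hne : (1 - 4 * (n : ℂ) ^ 2) ≠ 0 := by
    have : (1 - 4 * n ^ 2 : ℤ) ≠ 0 := by omega
    exact_mod_cast this
  have hderiv : ∀ x ∈ Set.uIcc (0 : ℝ) Real.pi,
      HasDerivAt (fun x : ℝ => Complex.exp (-(2 * n * x) * Complex.I) *
        (-(2 * n) * Complex.I * Complex.sin x - Complex.cos x) / (1 - 4 * (n : ℂ) ^ 2))
        (Complex.exp (-(2 * n * x) * Complex.I) * (Real.sin x : ℂ)) x := by
    intro x _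
    have hx : HasDerivAt (fun y : ℝ => (y : ℂ)) 1 x := Complex.ofRealCLM.hasDerivAt
    have he : HasDerivAt (fun y : ℝ => Complex.exp (-(2 * n * y) * Complex.I))
        (Complex.exp (-(2 * n * x) * Complex.I) * (-(2 * n * 1) * Complex.I)) x :=
      (((hx.const_mul (2 * (n : ℂ))).neg).mul_const Complex.I).cexp
    have hs : HasDerivAt (fun y : ℝ => Complex.sin y) (Complex.cos x * 1) x :=
      (Complex.hasDerivAt_sin x).comp x hx
    have hc : HasDerivAt (fun y : ℝ => Complex.cos y) (-Complex.sin x * 1) x :=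
      (Complex.hasDerivAt_cos x).comp x hx
    convert! ((he.mul ((hs.const_mul (-(2 * (n : ℂ)) * Complex.I)).sub hc)).div_const
      (1 - 4 * (n : ℂ) ^ 2)) using 1
    rw [eq_div_iff hne, Complex.ofReal_sin, Pi.sub_apply]
    linear_combination (-4 * (n : ℂ) ^ 2 * Complex.exp (-(2 * n * x) * Complex.I) *
      Complex.sin x) * Complex.I_sq
  rw [intervalIntegral.integral_eq_sub_of_hasDerivAt hderiv]
  · have : Complex.exp (-(2 * n * (Real.pi : ℂ)) * Complex.I) = 1 := by
      rw [Complex.exp_eq_one_iff]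
      exact ⟨-n, by push_cast; ring⟩
    rw [this]
    simp
    field_simp
    norm_num
  · apply Continuous.intervalIntegrable
    fun_prop

theorem periodic_abs_sin : Function.Periodic (fun x : ℝ => ((|Real.sin x| : ℝ) : ℂ)) Real.pi := by
  intro x
  simp [Real.sin_add_pi]

theorem summable_abs_sin_coeff :
    Summable (fun n : ℤ => 2 / (Real.pi * (1 - 4 * (n : ℝ) ^ 2))) := by
  have h := (Real.summable_one_div_int_pow (p := 2)).2 one_lt_two
  refine Summable.of_norm_bounded_eventually (g := fun n : ℤ => 1 / (n : ℝ) ^ 2) h ?_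
  rw [Filter.eventually_cofinite]
  refine (Set.finite_singleton (0 : ℤ)).subset fun n hn => ?_
  by_contra hn0
  apply hn
  have h1 : (1 : ℝ) ≤ (n : ℝ) ^ 2 := by
    have : (1 : ℤ) ≤ n ^ 2 := by
      have : n ≠ 0 := hn0
      have := sq_pos_of_ne_zero this
      omega
    exact_mod_cast this
  have hpi := Real.pi_gt_three
  rw [Real.norm_eq_abs, abs_div, abs_mul, abs_of_pos Real.pi_pos, abs_two,
    abs_of_neg (by linarith : 1 - 4 * (n : ℝ) ^ 2 < 0),
    div_le_div_iff₀ (by nlinarith) (by linarith)]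
  nlinarith

theorem hasSum_abs_sin (t : ℝ) :
    HasSum (fun n : ℤ => 2 / (Real.pi * (1 - 4 * (n : ℝ) ^ 2)) * Real.cos (2 * n * t))
      |Real.sin t| := by
  have : Fact (0 < Real.pi) := ⟨Real.pi_pos⟩
  let f : C(AddCircle Real.pi, ℂ) :=
    ⟨periodic_abs_sin.lift, continuous_coinduced_dom.2
      (by
        change Continuous (fun x : ℝ => ((|Real.sin x| : ℝ) : ℂ))
        fun_prop)⟩
  have hf : ∀ x : ℝ, f (x : AddCircle Real.pi) = ((|Real.sin x| : ℝ) : ℂ) := fun x => rfl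
  have hcoeff : ∀ n : ℤ, fourierCoeff f n = ((2 / (Real.pi * (1 - 4 * (n : ℝ) ^ 2)) : ℝ) : ℂ) := by
    intro n
    rw [fourierCoeff_eq_intervalIntegral _ n 0, zero_add]
    have : ∫ x in (0 : ℝ)..Real.pi, (fourier (-n) (x : AddCircle Real.pi)) • f x =
        ∫ x in (0 : ℝ)..Real.pi, Complex.exp (-(2 * n * x) * Complex.I) * (Real.sin x : ℂ) := by
      refine intervalIntegral.integral_congr fun x hx => ?_
      rw [Set.uIcc_of_le Real.pi_pos.le] at hx
      simp only [hf, fourier_coe_apply, smul_eq_mul]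
      rw [abs_of_nonneg (Real.sin_nonneg_of_nonneg_of_le_pi hx.1 hx.2)]
      congr 2
      have := Real.pi_ne_zero
      push_cast
      field_simp
    rw [this, integral_exp_mul_sin]
    have := Real.pi_ne_zero
    simp only [Complex.real_smul]
    push_cast
    rw [div_mul_div_comm, one_mul]
  have hs : Summable (fourierCoeff f) := by
    rw [show fourierCoeff f = _ from funext hcoeff]
    exact summable_abs_sin_coeff.map Complex.ofRealCLM Complex.ofRealCLM.continuous
  have := has_pointwise_sum_fourier_series_of_summable hs (t : AddCircle Real.pi)
  have h2 := Complex.hasSum_re this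
  rw [hf, Complex.ofReal_re] at h2
  convert h2 using 2 with n
  rw [hcoeff, smul_eq_mul, Complex.re_ofReal_mul, fourier_coe_apply]
  have hpi := Real.pi_ne_zero
  have : (2 * Real.pi * Complex.I * n * t / Real.pi : ℂ) = ((2 * n * t : ℝ) : ℂ) * Complex.I := by
    push_cast
    have : (Real.pi : ℂ) ≠ 0 := by exact_mod_cast hpi
    field_simp
  rw [this, Complex.exp_ofReal_mul_I_re]

/-- Write `|sin t| = ∑ a n * cos (2 n t)`. Evaluating at `t = 0` gives `∑ a n = 0`, so `|sin t| = ∑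
(-a n) * (1 - cos (2 n t))` over `n ≠ 0`. There `-a n ≥ 0`, so the hypothesis applies frequency by
frequency, and these coefficients total `a 0 = 2 / π`. -/
theorem sum_mul_abs_sin_le {ι : Type*} (s : Finset ι) (w x : ι → ℝ) (c : ℝ)
    (h : ∀ n : ℤ, -c ≤ ∑ i ∈ s, w i * Real.cos (2 * n * x i)) :
    ∑ i ∈ s, w i * |Real.sin (x i)| ≤ 2 / Real.pi * (∑ i ∈ s, w i + c) := by
  set a : ℤ → ℝ := fun n => 2 / (Real.pi * (1 - 4 * (n : ℝ) ^ 2)) with ha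
  have h0 : HasSum a 0 := by simpa using hasSum_abs_sin 0
  have h1 : HasSum (fun n : ℤ => if n = 0 then 2 / Real.pi else 0) (2 / Real.pi) :=
    hasSum_ite_eq 0 _
  have h2 : HasSum (fun n => ((if n = 0 then 2 / Real.pi else 0) - a n) * (∑ i ∈ s, w i + c))
      (2 / Real.pi * (∑ i ∈ s, w i + c)) := by
    simpa using (h1.sub h0).mul_right (∑ i ∈ s, w i + c)
  have h3 : HasSum (fun n : ℤ => ∑ i ∈ s, w i * (a n * Real.cos (2 * n * x i) - a n))
      (∑ i ∈ s, w i * |Real.sin (x i)|) := by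
    refine hasSum_sum fun i _ => ?_
    simpa using ((hasSum_abs_sin (x i)).sub h0).mul_left (w i)
  refine hasSum_le (fun n => ?_) h3 h2
  have e : ∑ i ∈ s, w i * (a n * Real.cos (2 * n * x i) - a n) =
      (-a n) * (∑ i ∈ s, w i - ∑ i ∈ s, w i * Real.cos (2 * n * x i)) := by
    rw [mul_sub, Finset.mul_sum, Finset.mul_sum, ← Finset.sum_sub_distrib]
    exact Finset.sum_congr rfl fun i _ => by ring
  rw [e]
  by_cases hn : n = 0
  · subst hn
    simp [ha]
  · rw [if_neg hn, zero_sub]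
    have hn1 : (1 : ℝ) ≤ (n : ℝ) ^ 2 := by
      have : (1 : ℤ) ≤ n ^ 2 := by
        have := sq_pos_of_ne_zero hn
        omega
      exact_mod_cast this
    have : 0 ≤ -a n := by
      rw [ha, neg_nonneg]
      exact div_nonpos_of_nonneg_of_nonpos zero_le_two
        (mul_nonpos_of_nonneg_of_nonpos Real.pi_pos.le (by linarith))
    exact mul_le_mul_of_nonneg_left (by linarith [h n]) this

/-- The sum of the weights `1/k - 1/R`, `1 ≤ k ≤ R`. -/
theorem sum_truncated_inv (n : ℕ) :
    ∑ k ∈ Finset.range (n + 1), (1 / ((k + 1 : ℕ) : ℝ) - 1 / ((n + 1 : ℕ) : ℝ)) =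
      (harmonic (n + 1) : ℝ) - 1 := by
  rw [Finset.sum_sub_distrib, Finset.sum_const, Finset.card_range, nsmul_eq_mul,
    mul_one_div_cancel (by positivity), harmonic]
  push_cast
  simp

theorem sum_truncated_inv_mul_abs_sin_le (α : ℝ) (n : ℕ) :
    ∑ k ∈ Finset.range (n + 1),
      (1 / ((k + 1 : ℕ) : ℝ) - 1 / ((n + 1 : ℕ) : ℝ)) * |Real.sin ((k + 1 : ℕ) * α)| ≤
        2 / Real.pi * ((harmonic (n + 1) : ℝ) - 1 / 4) := by
  refine (sum_mul_abs_sin_le _ _ _ (3 / 4) fun m => ?_).trans_eq ?_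
  · refine (neg_three_quarters_le_sum_mul_cos (2 * m * α) n).trans_eq
      (Finset.sum_congr rfl fun k _ => ?_)
    congr 2
    ring
  · rw [sum_truncated_inv]
    ring

theorem sum_truncated_inv_mul_sin_sq_le (α : ℝ) (n : ℕ) :
    ∑ k ∈ Finset.range (n + 1),
      (1 / ((k + 1 : ℕ) : ℝ) - 1 / ((n + 1 : ℕ) : ℝ)) * Real.sin ((k + 1 : ℕ) * α) ^ 2 ≤
        1 / 2 * ((harmonic (n + 1) : ℝ) - 1 / 4) := by
  have h := neg_three_quarters_le_sum_mul_cos (2 * α) n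
  have e : ∑ k ∈ Finset.range (n + 1),
      (1 / ((k + 1 : ℕ) : ℝ) - 1 / ((n + 1 : ℕ) : ℝ)) * Real.sin ((k + 1 : ℕ) * α) ^ 2 =
      1 / 2 * (∑ k ∈ Finset.range (n + 1), (1 / ((k + 1 : ℕ) : ℝ) - 1 / ((n + 1 : ℕ) : ℝ)) -
        ∑ k ∈ Finset.range (n + 1), (1 / ((k + 1 : ℕ) : ℝ) - 1 / ((n + 1 : ℕ) : ℝ)) *
          Real.cos ((k + 1 : ℕ) * (2 * α))) := by
    rw [← Finset.sum_sub_distrib, Finset.mul_sum]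
    refine Finset.sum_congr rfl fun k _ => ?_
    rw [show ((k + 1 : ℕ) : ℝ) * (2 * α) = 2 * ((k + 1 : ℕ) * α) by ring, Real.cos_two_mul,
      Real.cos_sq']
    ring
  rw [e, sum_truncated_inv]
  linarith

/-- By AM–GM the product is at most the average of the two squares, whose mean is `1/2`. This
improves on the `2 / π` available from one sine alone. -/
theorem sum_truncated_inv_mul_abs_sin_mul_sin_le (α β : ℝ) (n : ℕ) :
    ∑ k ∈ Finset.range (n + 1),
      (1 / ((k + 1 : ℕ) : ℝ) - 1 / ((n + 1 : ℕ) : ℝ)) *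
        (|Real.sin ((k + 1 : ℕ) * α)| * |Real.sin ((k + 1 : ℕ) * β)|) ≤
        1 / 2 * ((harmonic (n + 1) : ℝ) - 1 / 4) := by
  have h1 := sum_truncated_inv_mul_sin_sq_le α n
  have h2 := sum_truncated_inv_mul_sin_sq_le β n
  have h3 : ∑ k ∈ Finset.range (n + 1),
      (1 / ((k + 1 : ℕ) : ℝ) - 1 / ((n + 1 : ℕ) : ℝ)) *
        (|Real.sin ((k + 1 : ℕ) * α)| * |Real.sin ((k + 1 : ℕ) * β)|) ≤
      1 / 2 * (∑ k ∈ Finset.range (n + 1), (1 / ((k + 1 : ℕ) : ℝ) - 1 / ((n + 1 : ℕ) : ℝ)) *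
          Real.sin ((k + 1 : ℕ) * α) ^ 2 +
        ∑ k ∈ Finset.range (n + 1), (1 / ((k + 1 : ℕ) : ℝ) - 1 / ((n + 1 : ℕ) : ℝ)) *
          Real.sin ((k + 1 : ℕ) * β) ^ 2) := by
    rw [← Finset.sum_add_distrib, Finset.mul_sum]
    refine Finset.sum_le_sum fun k hk => ?_
    have hw : 0 ≤ 1 / ((k + 1 : ℕ) : ℝ) - 1 / ((n + 1 : ℕ) : ℝ) := by
      rw [sub_nonneg]
      apply one_div_le_one_div_of_le (by positivity)
      exact_mod_cast Finset.mem_range.1 hk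
    rw [← mul_add, mul_left_comm (1 / 2 : ℝ)]
    refine mul_le_mul_of_nonneg_left ?_ hw
    rw [← sq_abs (Real.sin ((k + 1 : ℕ) * α)), ← sq_abs (Real.sin ((k + 1 : ℕ) * β))]
    nlinarith [sq_nonneg (|Real.sin ((k + 1 : ℕ) * α)| - |Real.sin ((k + 1 : ℕ) * β)|)]
  linarith

/-- Primitivity gives `χ⁻¹ a * τ = ∑ χ x * e (a x)` for every `a`, units or not. Inserting this in
`star τ * τ` and summing over `a` leaves only `x = 1`, by orthogonality. -/
theorem norm_gaussSum_stdAddChar {q : ℕ} [NeZero q] {χ : DirichletCharacter ℂ q}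
    (hχ : χ.IsPrimitive) : ‖gaussSum χ ZMod.stdAddChar‖ = √q := by
  set τ := gaussSum χ ZMod.stdAddChar with hτ
  have h1 : star τ * τ = q := by
    rw [hτ, star_gaussSum_eq, gaussSum, Finset.sum_mul]
    calc ∑ a, χ⁻¹ a * (ZMod.stdAddChar (N := q))⁻¹ a * gaussSum χ ZMod.stdAddChar
        = ∑ a : ZMod q, ∑ x, χ x * ZMod.stdAddChar (N := q) (a * (x - 1)) := by
          refine Finset.sum_congr rfl fun a _ => ?_
          rw [mul_right_comm, ← gaussSum_mulShift_of_isPrimitive _ hχ, gaussSum, Finset.sum_mul]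
          refine Finset.sum_congr rfl fun x _ => ?_
          rw [AddChar.mulShift_apply, AddChar.inv_apply, mul_assoc, ← AddChar.map_add_eq_mul]
          congr 2
          ring
      _ = ∑ x, χ x * ∑ a : ZMod q, ZMod.stdAddChar (N := q) (a * (x - 1)) := by
          rw [Finset.sum_comm]
          simp_rw [Finset.mul_sum]
      _ = q := by
          simp_rw [AddChar.sum_mulShift _ (ZMod.isPrimitive_stdAddChar q), sub_eq_zero]
          simp
  rw [Complex.star_def, Complex.conj_mul'] at h1
  have h2 : ‖τ‖ ^ 2 = q := by exact_mod_cast h1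
  rw [← h2, Real.sqrt_sq (norm_nonneg _)]

/-! ### The sawtooth convolution, its Fourier series and smoothing. -/

/-- The convolution of a character with the sawtooth `n ↦ n mod q`. -/
noncomputable def sawtoothSum {q : ℕ} [NeZero q] (χ : DirichletCharacter ℂ q) (a : ZMod q) : ℂ :=
  ∑ n, χ n * ((a - n).val : ℂ)

/-- The convolution of a character with the cosine of frequency `k`. -/
noncomputable def cosineSum {q : ℕ} [NeZero q] (χ : DirichletCharacter ℂ q) (k : ℕ)
    (a : ZMod q) : ℂ :=
  ∑ n, χ n * ((ZMod.stdAddChar (N := q) (k * (a - n)) + ZMod.stdAddChar (N := q) (-(k * (a - n)))) / 2)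

theorem ZMod.val_add_one_eq {q : ℕ} [NeZero q] (c : ZMod q) :
    ((c + 1).val : ℂ) = c.val + 1 - if c + 1 = 0 then (q : ℂ) else 0 := by
  have h1 : (c + 1).val = (c.val + 1) % q := by
    rw [ZMod.val_add, ZMod.val_one_eq_one_mod, Nat.add_mod_mod]
  have h2 := ZMod.val_lt c
  split_ifs with h
  · have h3 : (c.val + 1) % q = 0 := by rw [← h1, h, ZMod.val_zero]
    have h4 : c.val + 1 = q :=
      le_antisymm h2 (Nat.le_of_dvd (Nat.succ_pos _) (Nat.dvd_of_mod_eq_zero h3))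
    have h5 : (c.val : ℂ) + 1 = q := by exact_mod_cast h4
    rw [h, ZMod.val_zero, h5]
    simp
  · have h3 : c.val + 1 ≠ q := by
      intro h4
      apply h
      rw [← ZMod.val_eq_zero, h1, h4, Nat.mod_self]
    rw [h1, Nat.mod_eq_of_lt (by omega)]
    simp

/-- The sawtooth rises by `1` at each step, except for an extra drop of `q` at the wrap-around. The
rise contributes `∑ χ = 0`; the drop picks out a single value of `χ`. -/
theorem sawtoothSum_add_one_sub {q : ℕ} [NeZero q] {χ : DirichletCharacter ℂ q} (hχ : χ ≠ 1)
    (a : ZMod q) : sawtoothSum χ (a + 1) - sawtoothSum χ a = -(q * χ (a + 1)) := by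
  rw [sawtoothSum, sawtoothSum, ← Finset.sum_sub_distrib]
  have : ∀ n, χ n * ((a + 1 - n).val : ℂ) - χ n * ((a - n).val : ℂ) =
      χ n - if n = a + 1 then q * χ n else 0 := by
    intro n
    have h0 : a - n + 1 = 0 ↔ n = a + 1 := by rw [← add_sub_right_comm, sub_eq_zero, eq_comm]
    rw [add_sub_right_comm, ZMod.val_add_one_eq]
    simp only [h0]
    split_ifs <;> ring
  simp_rw [this]
  rw [Finset.sum_sub_distrib, MulChar.sum_eq_zero_of_ne_one hχ, Finset.sum_ite_eq']
  simp

theorem sum_Icc_eq_sawtoothSum {q : ℕ} [NeZero q] {χ : DirichletCharacter ℂ q} (hχ : χ ≠ 1)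
    {M N : ℕ} (h : M ≤ N) :
    q * ∑ n ∈ Finset.Icc M N, χ (n : ZMod q) =
      sawtoothSum χ (M - 1) - sawtoothSum χ N := by
  induction N, h using Nat.le_induction with
  | base =>
    have := sawtoothSum_add_one_sub hχ ((M : ZMod q) - 1)
    rw [sub_add_cancel] at this
    rw [Finset.Icc_self, Finset.sum_singleton]
    linear_combination this
  | succ N h ih =>
    rw [← Finset.insert_Icc_right_eq_Icc_add_one (by omega), Finset.sum_insert (by simp), mul_add, ih]
    push_cast
    linear_combination sawtoothSum_add_one_sub hχ (N : ZMod q)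

theorem norm_sawtoothSum_add_sub_le {q : ℕ} [NeZero q] {χ : DirichletCharacter ℂ q} (hχ : χ ≠ 1)
    (a : ZMod q) (s : ℕ) : ‖sawtoothSum χ (a + s) - sawtoothSum χ a‖ ≤ q * s := by
  induction s with
  | zero => simp
  | succ s ih =>
    have h := sawtoothSum_add_one_sub hχ (a + s)
    have e : sawtoothSum χ (a + (s + 1 : ℕ)) - sawtoothSum χ a =
        -(q * χ (a + s + 1)) + (sawtoothSum χ (a + s) - sawtoothSum χ a) := by
      rw [← h]
      push_cast
      rw [← add_assoc]
      ring
    rw [e]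
    refine (norm_add_le _ _).trans ?_
    have h1 : ‖-((q : ℂ) * χ (a + s + 1))‖ ≤ q := by
      rw [norm_neg, norm_mul, Complex.norm_natCast]
      exact mul_le_of_le_one_right (Nat.cast_nonneg _) (χ.norm_le_one _)
    push_cast
    linarith

theorem stdAddChar_add_stdAddChar_neg {q : ℕ} [NeZero q] (k : ℕ) (j : ℤ) :
    (ZMod.stdAddChar (N := q) ((k : ZMod q) * j) + ZMod.stdAddChar (N := q) (-((k : ZMod q) * j))) / 2 =
      ((Real.cos (2 * Real.pi * k * (j / q)) : ℝ) : ℂ) := by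
  have h1 : ((k : ZMod q) * j) = ((k * j : ℤ) : ZMod q) := by push_cast; ring
  have h2 : -((k : ZMod q) * j) = ((-(k * j) : ℤ) : ZMod q) := by push_cast; ring
  rw [h2, h1, ZMod.stdAddChar_coe, ZMod.stdAddChar_coe, Complex.ofReal_cos, Complex.cos]
  congr 3 <;> (push_cast; ring)

theorem hasSum_cos_sub_cos {x y : ℝ} (hx : x ∈ Set.Icc (0 : ℝ) 1) (hy : y ∈ Set.Icc (0 : ℝ) 1) :
    HasSum (fun k : ℕ => (Real.cos (2 * Real.pi * k * y) - Real.cos (2 * Real.pi * k * x)) /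
      (k : ℝ) ^ 2) (Real.pi ^ 2 * (y ^ 2 - y - (x ^ 2 - x))) := by
  have h : ∀ {x : ℝ}, x ∈ Set.Icc (0 : ℝ) 1 →
      HasSum (fun n : ℕ => 1 / (n : ℝ) ^ 2 * Real.cos (2 * Real.pi * n * x))
        (Real.pi ^ 2 * (x ^ 2 - x + 1 / 6)) := by
    intro x hx
    convert! hasSum_one_div_nat_pow_mul_cos one_ne_zero hx using 1
    have : Polynomial.bernoulli 2 = Polynomial.X ^ 2 - Polynomial.X + Polynomial.C (1 / 6 : ℚ) := by
      simp [Polynomial.bernoulli, Finset.sum_range_succ, bernoulli_one, bernoulli_two,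
        ← Polynomial.C_mul_X_pow_eq_monomial]
      have h2 : (Polynomial.C (-1 / 2) * 2 : Polynomial ℚ) = -1 := by
        rw [← map_ofNat Polynomial.C 2, ← Polynomial.C_mul]
        norm_num
      linear_combination Polynomial.X * h2
    rw [mul_one, this]
    simp [Nat.factorial]
    left
    ring
  convert! (h hy).sub (h hx) using 1
  · ext k
    ring
  · ring

/-- A unit difference of the quadratic Bernoulli polynomial is affine in `a.val`. Since `a.val + 1 ≤
q`, both arguments lie in `[0, 1]`, so the wrap-around needs no separate case. -/
theorem hasSum_stdAddChar_sawtooth {q : ℕ} [NeZero q] (a : ZMod q) :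
    HasSum (fun k : ℕ =>
      ((ZMod.stdAddChar (N := q) ((k : ZMod q) * (a + 1)) + ZMod.stdAddChar (N := q) (-((k : ZMod q) * (a + 1)))) / 2 -
        (ZMod.stdAddChar (N := q) ((k : ZMod q) * a) + ZMod.stdAddChar (N := q) (-((k : ZMod q) * a))) / 2) /
          (k : ℂ) ^ 2)
      ((Real.pi : ℂ) ^ 2 * (2 * a.val / q ^ 2 + 1 / q ^ 2 - 1 / q)) := by
  have hq : (0 : ℝ) < q := by exact_mod_cast Nat.pos_of_ne_zero (NeZero.ne q)
  have hv : (a.val : ℝ) + 1 ≤ q := by exact_mod_cast ZMod.val_lt a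
  have hv0 : (0 : ℝ) ≤ a.val := Nat.cast_nonneg _
  have h := hasSum_cos_sub_cos (x := a.val / q) (y := (a.val + 1) / q)
    ⟨by positivity, (div_le_one hq).2 (by linarith)⟩ ⟨by positivity, (div_le_one hq).2 hv⟩
  have h' := Complex.hasSum_ofReal.2 h
  convert! h' using 1
  · ext k
    have e1 := stdAddChar_add_stdAddChar_neg (q := q) k a.val
    have e2 := stdAddChar_add_stdAddChar_neg (q := q) k (a.val + 1)
    rw [show ((a.val : ℤ) : ZMod q) = a by simp] at e1
    rw [show ((a.val + 1 : ℤ) : ZMod q) = a + 1 by simp] at e2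
    rw [e1, e2]
    push_cast
    rfl
  · push_cast
    have : (q : ℂ) ≠ 0 := by exact_mod_cast hq.ne'
    field_simp
    ring

theorem hasSum_cosineSum {q : ℕ} [NeZero q] {χ : DirichletCharacter ℂ q} (hχ : χ ≠ 1)
    (a : ZMod q) :
    HasSum (fun k : ℕ => (cosineSum χ k (a + 1) - cosineSum χ k a) / (k : ℂ) ^ 2)
      (2 * (Real.pi : ℂ) ^ 2 / q ^ 2 * sawtoothSum χ a) := by
  have h := hasSum_sum (s := Finset.univ) fun (n : ZMod q) _ =>
    (hasSum_stdAddChar_sawtooth (a - n)).mul_left (χ n)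
  convert! h using 1
  · ext k
    rw [cosineSum, cosineSum, ← Finset.sum_sub_distrib, Finset.sum_div]
    refine Finset.sum_congr rfl fun n _ => ?_
    rw [show a + 1 - n = a - n + 1 by ring]
    ring
  · have e : ∀ n : ZMod q, χ n * ((Real.pi : ℂ) ^ 2 *
        (2 * (a - n).val / q ^ 2 + 1 / q ^ 2 - 1 / q)) =
        2 * (Real.pi : ℂ) ^ 2 / q ^ 2 * (χ n * (a - n).val) +
          χ n * ((Real.pi : ℂ) ^ 2 * (1 / q ^ 2 - 1 / q)) := fun n => by ring
    simp_rw [e]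
    rw [Finset.sum_add_distrib, ← Finset.sum_mul, MulChar.sum_eq_zero_of_ne_one hχ, zero_mul,
      add_zero, ← Finset.mul_sum, sawtoothSum]

theorem hasSum_cosineSum_range {q : ℕ} [NeZero q] {χ : DirichletCharacter ℂ q} (hχ : χ ≠ 1)
    (a : ZMod q) (h : ℕ) :
    HasSum (fun k : ℕ => (cosineSum χ k (a + h) - cosineSum χ k a) / (k : ℂ) ^ 2)
      (2 * (Real.pi : ℂ) ^ 2 / q ^ 2 * ∑ s ∈ Finset.range h, sawtoothSum χ (a + s)) := by
  have := hasSum_sum (s := Finset.range h) fun (s : ℕ) _ => hasSum_cosineSum hχ (a + s)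
  convert! this using 1
  · ext k
    rw [← Finset.sum_div]
    congr 1
    have := Finset.sum_range_sub (fun s : ℕ => cosineSum χ k (a + s)) h
    rw [Nat.cast_zero, add_zero] at this
    rw [← this]
    refine Finset.sum_congr rfl fun s _ => ?_
    rw [Nat.cast_succ, add_assoc]
  · rw [Finset.mul_sum]

/-- The mixed second difference of `cosineSum χ k`. -/
noncomputable def cosineSumDiff {q : ℕ} [NeZero q] (χ : DirichletCharacter ℂ q) (h : ℕ)
    (x y : ZMod q) (k : ℕ) : ℂ :=
  cosineSum χ k (x + h) - cosineSum χ k x - (cosineSum χ k (y + h) - cosineSum χ k y)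

theorem sum_abs_sub_half_le (h : ℕ) :
    ∑ s ∈ Finset.range h, |(s : ℝ) - (h / 2 : ℕ)| ≤ (h : ℝ) ^ 2 / 4 := by
  have key : ∀ m j : ℕ, ∑ s ∈ Finset.range (m + j), |(s : ℝ) - m| =
      m * (m + 1) / 2 + j * (j - 1) / 2 := by
    intro m j
    induction j with
    | zero =>
      rw [← Finset.sum_range_reflect]
      have : ∀ s ∈ Finset.range (m + 0), |((m + 0 - 1 - s : ℕ) : ℝ) - m| = s + 1 := by
        intro s hs
        have hs' := Finset.mem_range.1 hs
        rw [show m + 0 - 1 - s = m - (s + 1) by omega, Nat.cast_sub (by omega)]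
        push_cast
        rw [show (m : ℝ) - (s + 1) - m = -((s : ℝ) + 1) by ring, abs_neg, abs_of_nonneg (by positivity)]
      rw [Finset.sum_congr rfl this]
      have : ∀ m : ℕ, ∑ s ∈ Finset.range m, ((s : ℝ) + 1) = m * (m + 1) / 2 := by
        intro m
        induction m with
        | zero => simp
        | succ m ih => rw [Finset.sum_range_succ, ih]; push_cast; ring
      rw [add_zero, this]
      simp
    | succ j ih =>
      rw [← add_assoc, Finset.sum_range_succ, ih]
      push_cast
      rw [add_sub_cancel_left, abs_of_nonneg (by positivity)]
      ring
  obtain ⟨m, rfl | rfl⟩ := Nat.even_or_odd' h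
  · rw [show 2 * m / 2 = m by omega, two_mul, key]
    push_cast
    nlinarith
  · rw [show (2 * m + 1) / 2 = m by omega, show 2 * m + 1 = m + (m + 1) by ring, key]
    push_cast
    nlinarith

theorem norm_sawtoothSum_shift_le {q : ℕ} [NeZero q] {χ : DirichletCharacter ℂ q} (hχ : χ ≠ 1)
    (a : ZMod q) (m s : ℕ) :
    ‖sawtoothSum χ (a - m + s) - sawtoothSum χ a‖ ≤ q * |(s : ℝ) - m| := by
  rcases le_total m s with h | h
  · obtain ⟨j, rfl⟩ := Nat.exists_eq_add_of_le h
    have := norm_sawtoothSum_add_sub_le hχ a j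
    push_cast
    rw [show a - (m : ZMod q) + (m + j) = a + j by ring, add_sub_cancel_left, Nat.abs_cast]
    exact this
  · obtain ⟨j, rfl⟩ := Nat.exists_eq_add_of_le h
    have := norm_sawtoothSum_add_sub_le hχ (a - j) j
    rw [sub_add_cancel] at this
    push_cast
    rw [show a - ((s : ZMod q) + j) + s = a - j by ring, norm_sub_rev,
      show (s : ℝ) - (s + j) = -(j : ℝ) by ring, abs_neg, Nat.abs_cast]
    exact this

theorem norm_sum_Icc_le_of_cosineSumDiff {q : ℕ} [NeZero q] {χ : DirichletCharacter ℂ q}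
    (hχ : χ ≠ 1) {M N : ℕ} (hMN : M ≤ N) {h : ℕ} (hh : 0 < h) {B : ℝ}
    (hB : ∀ (x y : ZMod q) (K : ℕ),
      ∑ k ∈ Finset.range K, ‖cosineSumDiff χ h x y (k + 1)‖ / ((k + 1 : ℕ) : ℝ) ^ 2 ≤ B) :
    ‖∑ n ∈ Finset.Icc M N, χ (n : ZMod q)‖ ≤ h / 2 + q / (2 * Real.pi ^ 2 * h) * B := by
  have hq : (0 : ℝ) < q := by exact_mod_cast Nat.pos_of_ne_zero (NeZero.ne q)
  have hh' : (0 : ℝ) < h := by exact_mod_cast hh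
  have hpi := Real.pi_pos
  set m := h / 2 with hm
  -- The window of `h` shifts is centred at each endpoint, which halves the Lipschitz error compared
  -- with a one-sided window.
  set x : ZMod q := N - m with hx
  set y : ZMod q := M - 1 - m with hy
  set V : ℂ := ∑ s ∈ Finset.range h, (sawtoothSum χ (x + s) - sawtoothSum χ (y + s)) with hV
  have hsum : HasSum (fun k : ℕ => cosineSumDiff χ h x y k / (k : ℂ) ^ 2)
      (2 * (Real.pi : ℂ) ^ 2 / q ^ 2 * V) := by
    convert! (hasSum_cosineSum_range hχ x h).sub (hasSum_cosineSum_range hχ y h) using 1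
    · ext k
      rw [cosineSumDiff, ← sub_div]
    · rw [hV, Finset.sum_sub_distrib, mul_sub]
  -- The term `k = 0` vanishes because division by zero gives zero.
  have hsum' := (hasSum_nat_add_iff' 1).2 hsum
  simp only [Finset.range_one, Finset.sum_singleton, Nat.cast_zero, ne_eq, OfNat.ofNat_ne_zero,
    not_false_eq_true, zero_pow, div_zero, sub_zero] at hsum'
  have hVB : 2 * Real.pi ^ 2 / q ^ 2 * ‖V‖ ≤ B := by
    have h1 : ‖2 * (Real.pi : ℂ) ^ 2 / q ^ 2 * V‖ ≤ B := by
      refine le_of_tendsto (hsum'.tendsto_sum_nat.norm) (Filter.Eventually.of_forall fun K => ?_)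
      refine (norm_sum_le _ _).trans ((Finset.sum_le_sum fun k _ => ?_).trans (hB x y K))
      rw [norm_div, norm_pow, Complex.norm_natCast]
    rwa [norm_mul, norm_div, norm_mul, norm_pow, norm_pow, Complex.norm_natCast,
      Complex.norm_real, Complex.norm_two, Real.norm_of_nonneg hpi.le] at h1
  have herr : ‖V - h * (sawtoothSum χ N - sawtoothSum χ (M - 1))‖ ≤ q * h ^ 2 / 2 := by
    have e : V - h * (sawtoothSum χ N - sawtoothSum χ (M - 1)) =
        ∑ s ∈ Finset.range h, ((sawtoothSum χ (N - m + s) - sawtoothSum χ N) -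
          (sawtoothSum χ (M - 1 - m + s) - sawtoothSum χ (M - 1))) := by
      rw [hV, ← nsmul_eq_mul, ← Finset.card_range h, ← Finset.sum_const, Finset.card_range,
        ← Finset.sum_sub_distrib]
      refine Finset.sum_congr rfl fun s _ => ?_
      ring
    rw [e]
    calc _ ≤ ∑ s ∈ Finset.range h, (2 * q) * |(s : ℝ) - m| := by
          refine (norm_sum_le _ _).trans (Finset.sum_le_sum fun s _ => ?_)
          refine (norm_sub_le _ _).trans ?_
          have h1 := norm_sawtoothSum_shift_le hχ (N : ZMod q) m s
          have h2 := norm_sawtoothSum_shift_le hχ (M - 1 : ZMod q) m s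
          linarith
      _ ≤ 2 * q * (h ^ 2 / 4) := by
          rw [← Finset.mul_sum]
          exact mul_le_mul_of_nonneg_left (sum_abs_sub_half_le h) (by positivity)
      _ = _ := by ring
  have hmain : q * h * ‖∑ n ∈ Finset.Icc M N, χ (n : ZMod q)‖ ≤ q * h ^ 2 / 2 + ‖V‖ := by
    have e : (q * h * ∑ n ∈ Finset.Icc M N, χ (n : ZMod q) : ℂ) =
        (V - h * (sawtoothSum χ N - sawtoothSum χ (M - 1))) - V := by
      linear_combination (h : ℂ) * sum_Icc_eq_sawtoothSum hχ hMN
    have h1 := congrArg norm e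
    rw [norm_mul, norm_mul, Complex.norm_natCast, Complex.norm_natCast] at h1
    rw [h1]
    exact (norm_sub_le _ _).trans (by linarith)
  have hVB' : ‖V‖ ≤ q ^ 2 / (2 * Real.pi ^ 2) * B := by
    have : ‖V‖ = q ^ 2 / (2 * Real.pi ^ 2) * (2 * Real.pi ^ 2 / q ^ 2 * ‖V‖) := by
      field_simp
    rw [this]
    exact mul_le_mul_of_nonneg_left hVB (by positivity)
  have : ‖∑ n ∈ Finset.Icc M N, χ (n : ZMod q)‖ ≤
      (q * h ^ 2 / 2 + q ^ 2 / (2 * Real.pi ^ 2) * B) / (q * h) := by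
    rw [le_div_iff₀ (by positivity)]
    linarith
  refine this.trans_eq ?_
  field_simp

/-! ### Evaluation of each frequency by the Gauss sum. -/

theorem cosineSum_eq {q : ℕ} [NeZero q] {χ : DirichletCharacter ℂ q} (hχ : χ.IsPrimitive)
    (k : ℕ) (a : ZMod q) :
    cosineSum χ k a = gaussSum χ ZMod.stdAddChar / 2 *
      (χ⁻¹ (-k) * ZMod.stdAddChar (N := q) (k * a) + χ⁻¹ k * ZMod.stdAddChar (N := q) (-(k * a))) := by
  have h1 := gaussSum_mulShift_of_isPrimitive ZMod.stdAddChar hχ (-k : ZMod q)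
  have h2 := gaussSum_mulShift_of_isPrimitive ZMod.stdAddChar hχ (k : ZMod q)
  have : gaussSum χ ZMod.stdAddChar / 2 *
      (χ⁻¹ (-k) * ZMod.stdAddChar (N := q) (k * a) + χ⁻¹ k * ZMod.stdAddChar (N := q) (-(k * a))) =
      ZMod.stdAddChar (N := q) (k * a) / 2 * (χ⁻¹ (-k) * gaussSum χ ZMod.stdAddChar) +
      ZMod.stdAddChar (N := q) (-(k * a)) / 2 * (χ⁻¹ k * gaussSum χ ZMod.stdAddChar) := by ring
  rw [this, ← h1, ← h2, gaussSum, gaussSum, Finset.mul_sum, Finset.mul_sum,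
    ← Finset.sum_add_distrib, cosineSum]
  refine Finset.sum_congr rfl fun n _ => ?_
  rw [AddChar.mulShift_apply, AddChar.mulShift_apply,
    show (k : ZMod q) * (a - n) = k * a + -k * n by ring,
    show -((k : ZMod q) * a + -k * n) = -(k * a) + k * n by ring,
    AddChar.map_add_eq_mul, AddChar.map_add_eq_mul]
  ring

theorem cosineSum_of_even {q : ℕ} [NeZero q] {χ : DirichletCharacter ℂ q} (hχ : χ.IsPrimitive)
    (he : χ.Even) (k : ℕ) (j : ℤ) :
    cosineSum χ k j = gaussSum χ ZMod.stdAddChar * χ⁻¹ k *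
      ((Real.cos (2 * Real.pi * k / q * j) : ℝ) : ℂ) := by
  have h1 : χ⁻¹ (-(k : ZMod q)) = χ⁻¹ k := by
    rw [← neg_one_mul, map_mul, MulChar.inv_apply_eq_inv', he, inv_one, one_mul]
  have h2 : 2 * Real.pi * k / q * j = 2 * Real.pi * k * (j / q) := by ring
  rw [cosineSum_eq hχ, h1, h2, ← stdAddChar_add_stdAddChar_neg]
  ring

theorem cosineSum_of_odd {q : ℕ} [NeZero q] {χ : DirichletCharacter ℂ q} (hχ : χ.IsPrimitive)
    (ho : χ.Odd) (k : ℕ) (j : ℤ) :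
    cosineSum χ k j = -Complex.I * gaussSum χ ZMod.stdAddChar * χ⁻¹ k *
      ((Real.sin (2 * Real.pi * k / q * j) : ℝ) : ℂ) := by
  have h1 : χ⁻¹ (-(k : ZMod q)) = -χ⁻¹ k := by
    rw [← neg_one_mul, map_mul, MulChar.inv_apply_eq_inv', ho, inv_neg, inv_one, neg_one_mul]
  have h2 : ((k : ZMod q) * j) = ((k * j : ℤ) : ZMod q) := by push_cast; ring
  have h3 : -((k : ZMod q) * j) = ((-(k * j) : ℤ) : ZMod q) := by push_cast; ring
  rw [cosineSum_eq hχ, h1, h3, h2, ZMod.stdAddChar_coe, ZMod.stdAddChar_coe, Complex.ofReal_sin,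
    Complex.sin]
  have h4 : (2 * Real.pi * Complex.I * (k * j : ℤ) / q : ℂ) =
      ((2 * Real.pi * k / q * j : ℝ) : ℂ) * Complex.I := by push_cast; ring
  have h5 : (2 * Real.pi * Complex.I * (-(k * j) : ℤ) / q : ℂ) =
      -((2 * Real.pi * k / q * j : ℝ) : ℂ) * Complex.I := by push_cast; ring
  rw [h4, h5]
  linear_combination (gaussSum χ ZMod.stdAddChar * χ⁻¹ (k : ZMod q) *
    (Complex.exp (-((2 * Real.pi * k / q * j : ℝ) : ℂ) * Complex.I) -
      Complex.exp (((2 * Real.pi * k / q * j : ℝ) : ℂ) * Complex.I)) / 2) * Complex.I_sq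

theorem cos_second_difference (θ x y h : ℝ) :
    Real.cos (2 * θ * (x + h)) - Real.cos (2 * θ * x) -
      (Real.cos (2 * θ * (y + h)) - Real.cos (2 * θ * y)) =
      -4 * Real.sin (θ * h) * Real.sin (θ * (x - y)) * Real.cos (θ * (x + y + h)) := by
  rw [Real.cos_sub_cos, Real.cos_sub_cos,
    show (2 * θ * (x + h) - 2 * θ * x) / 2 = θ * h by ring,
    show (2 * θ * (y + h) - 2 * θ * y) / 2 = θ * h by ring,
    show (2 * θ * (x + h) + 2 * θ * x) / 2 = θ * (x + y + h) + θ * (x - y) by ring,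
    show (2 * θ * (y + h) + 2 * θ * y) / 2 = θ * (x + y + h) - θ * (x - y) by ring,
    Real.sin_add, Real.sin_sub]
  ring

theorem sin_second_difference (θ x y h : ℝ) :
    Real.sin (2 * θ * (x + h)) - Real.sin (2 * θ * x) -
      (Real.sin (2 * θ * (y + h)) - Real.sin (2 * θ * y)) =
      -4 * Real.sin (θ * h) * Real.sin (θ * (x - y)) * Real.sin (θ * (x + y + h)) := by
  rw [Real.sin_sub_sin, Real.sin_sub_sin,
    show (2 * θ * (x + h) - 2 * θ * x) / 2 = θ * h by ring,
    show (2 * θ * (y + h) - 2 * θ * y) / 2 = θ * h by ring,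
    show (2 * θ * (x + h) + 2 * θ * x) / 2 = θ * (x + y + h) + θ * (x - y) by ring,
    show (2 * θ * (y + h) + 2 * θ * y) / 2 = θ * (x + y + h) - θ * (x - y) by ring,
    Real.cos_add, Real.cos_sub]
  ring

theorem norm_cosineSumDiff_of_even_le {q : ℕ} [NeZero q] {χ : DirichletCharacter ℂ q}
    (hχ : χ.IsPrimitive) (he : χ.Even) (h k : ℕ) (x y : ℤ) :
    ‖cosineSumDiff χ h x y k‖ ≤ 4 * √q * |Real.sin (k * (Real.pi * h / q))| *
      |Real.sin (k * (Real.pi * (x - y) / q))| := by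
  have hc : ∀ j : ℤ, (j : ZMod q) + h = ((j + h : ℤ) : ZMod q) := fun j => by push_cast; rfl
  have e : cosineSumDiff χ h x y k = gaussSum χ ZMod.stdAddChar * χ⁻¹ k *
      ((-4 * Real.sin (k * (Real.pi * h / q)) * Real.sin (k * (Real.pi * (x - y) / q)) *
        Real.cos (k * (Real.pi * (x + y + h) / q)) : ℝ) : ℂ) := by
    have := cos_second_difference (k * Real.pi / q) x y h
    rw [show (k : ℝ) * (Real.pi * h / q) = k * Real.pi / q * h by ring,
      show (k : ℝ) * (Real.pi * (x - y) / q) = k * Real.pi / q * (x - y) by ring,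
      show (k : ℝ) * (Real.pi * (x + y + h) / q) = k * Real.pi / q * (x + y + h) by ring, ← this,
      cosineSumDiff, hc, hc, cosineSum_of_even hχ he, cosineSum_of_even hχ he,
      cosineSum_of_even hχ he, cosineSum_of_even hχ he,
      show 2 * Real.pi * k / q = 2 * (k * Real.pi / q) by ring]
    push_cast
    ring
  rw [e, norm_mul, norm_mul, norm_gaussSum_stdAddChar hχ, Complex.norm_real, Real.norm_eq_abs,
    abs_mul, abs_mul, abs_mul, abs_neg, abs_of_pos (by norm_num : (0 : ℝ) < 4)]
  calc _ ≤ √q * 1 * (4 * |Real.sin (k * (Real.pi * h / q))| *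
        |Real.sin (k * (Real.pi * (x - y) / q))| * 1) := by
        gcongr
        · exact DirichletCharacter.norm_le_one _ _
        · exact Real.abs_cos_le_one _
    _ = _ := by ring

theorem norm_cosineSumDiff_of_odd_le {q : ℕ} [NeZero q] {χ : DirichletCharacter ℂ q}
    (hχ : χ.IsPrimitive) (ho : χ.Odd) (h k : ℕ) (x y : ℤ) :
    ‖cosineSumDiff χ h x y k‖ ≤ 4 * √q * |Real.sin (k * (Real.pi * h / q))| *
      (|Real.sin (k * (Real.pi * (x - y) / q))| *
        |Real.sin (k * (Real.pi * (x + y + h) / q))|) := by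
  have hc : ∀ j : ℤ, (j : ZMod q) + h = ((j + h : ℤ) : ZMod q) := fun j => by push_cast; rfl
  have e : cosineSumDiff χ h x y k = -Complex.I * gaussSum χ ZMod.stdAddChar * χ⁻¹ k *
      ((-4 * Real.sin (k * (Real.pi * h / q)) * Real.sin (k * (Real.pi * (x - y) / q)) *
        Real.sin (k * (Real.pi * (x + y + h) / q)) : ℝ) : ℂ) := by
    have := sin_second_difference (k * Real.pi / q) x y h
    rw [show (k : ℝ) * (Real.pi * h / q) = k * Real.pi / q * h by ring,
      show (k : ℝ) * (Real.pi * (x - y) / q) = k * Real.pi / q * (x - y) by ring,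
      show (k : ℝ) * (Real.pi * (x + y + h) / q) = k * Real.pi / q * (x + y + h) by ring, ← this,
      cosineSumDiff, hc, hc, cosineSum_of_odd hχ ho, cosineSum_of_odd hχ ho,
      cosineSum_of_odd hχ ho, cosineSum_of_odd hχ ho,
      show 2 * Real.pi * k / q = 2 * (k * Real.pi / q) by ring]
    push_cast
    ring
  rw [e, norm_mul, norm_mul, norm_mul, norm_neg, Complex.norm_I, one_mul,
    norm_gaussSum_stdAddChar hχ, Complex.norm_real, Real.norm_eq_abs,
    abs_mul, abs_mul, abs_mul, abs_neg, abs_of_pos (by norm_num : (0 : ℝ) < 4)]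
  calc _ ≤ √q * 1 * (4 * |Real.sin (k * (Real.pi * h / q))| *
        |Real.sin (k * (Real.pi * (x - y) / q))| *
          |Real.sin (k * (Real.pi * (x + y + h) / q))|) := by
        gcongr
        exact DirichletCharacter.norm_le_one _ _
    _ = _ := by ring

/-! ### Summation over frequencies. -/

theorem sum_inv_sq_tail_le (R K : ℕ) (hR : 0 < R) :
    ∑ i ∈ Finset.range K, 1 / ((R + i + 1 : ℕ) : ℝ) ^ 2 ≤ 1 / (R : ℝ) - 1 / ((R + K : ℕ) : ℝ) := by
  induction K with
  | zero => simp
  | succ K ih =>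
    rw [Finset.sum_range_succ]
    have h : (0 : ℝ) < (R + K : ℕ) := by exact_mod_cast (by omega : 0 < R + K)
    have : 1 / ((R + K + 1 : ℕ) : ℝ) ^ 2 ≤
        1 / ((R + K : ℕ) : ℝ) - 1 / ((R + (K + 1) : ℕ) : ℝ) := by
      rw [← add_assoc, Nat.cast_succ (R + K), div_sub_div _ _ h.ne' (by positivity),
        div_le_div_iff₀ (by positivity) (by positivity)]
      nlinarith
    linarith

/-- Split at `R = n + 1`. Below, `|sin (k t)| ≤ k t` leaves `t * u k / k`, and replacing `1/k` by
`1/k - 1/R` costs at most `t` in total. Above, the tail of `∑ 1 / k ^ 2` is at most `1 / R ≤ t`.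
These two losses are the `2`. -/
theorem sum_abs_sin_mul_div_sq_le {t X : ℝ} {n : ℕ} {u : ℕ → ℝ} (ht : 0 < t)
    (hn : 1 ≤ ((n + 1 : ℕ) : ℝ) * t) (hu0 : ∀ k, 0 ≤ u k) (hu1 : ∀ k, u k ≤ 1)
    (hX : ∑ k ∈ Finset.range (n + 1),
      (1 / ((k + 1 : ℕ) : ℝ) - 1 / ((n + 1 : ℕ) : ℝ)) * u (k + 1) ≤ X) (K : ℕ) :
    ∑ k ∈ Finset.range K, |Real.sin ((k + 1 : ℕ) * t)| * u (k + 1) / ((k + 1 : ℕ) : ℝ) ^ 2 ≤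
      t * (X + 2) := by
  have hn0 : (0 : ℝ) < ((n + 1 : ℕ) : ℝ) := by positivity
  have hle : ∑ k ∈ Finset.range K,
      |Real.sin ((k + 1 : ℕ) * t)| * u (k + 1) / ((k + 1 : ℕ) : ℝ) ^ 2 ≤
      ∑ k ∈ Finset.range (n + 1 + K),
        |Real.sin ((k + 1 : ℕ) * t)| * u (k + 1) / ((k + 1 : ℕ) : ℝ) ^ 2 := by
    refine Finset.sum_le_sum_of_subset_of_nonneg (Finset.range_mono (by omega)) fun k _ _ => ?_
    have := hu0 (k + 1)
    positivity
  refine hle.trans ?_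
  rw [Finset.sum_range_add]
  have h1 : ∑ k ∈ Finset.range (n + 1),
      |Real.sin ((k + 1 : ℕ) * t)| * u (k + 1) / ((k + 1 : ℕ) : ℝ) ^ 2 ≤ t * (X + 1) := by
    calc _ ≤ ∑ k ∈ Finset.range (n + 1), t * ((1 / ((k + 1 : ℕ) : ℝ) - 1 / ((n + 1 : ℕ) : ℝ)) *
          u (k + 1) + 1 / ((n + 1 : ℕ) : ℝ)) := by
          refine Finset.sum_le_sum fun k _ => ?_
          have hk : (0 : ℝ) < ((k + 1 : ℕ) : ℝ) := by positivity
          have hs : |Real.sin ((k + 1 : ℕ) * t)| ≤ (k + 1 : ℕ) * t :=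
            Real.abs_sin_le_abs.trans_eq (abs_of_pos (by positivity))
          calc _ ≤ ((k + 1 : ℕ) : ℝ) * t * u (k + 1) / ((k + 1 : ℕ) : ℝ) ^ 2 := by
                have := hu0 (k + 1)
                gcongr
            _ = t * ((1 / ((k + 1 : ℕ) : ℝ) - 1 / ((n + 1 : ℕ) : ℝ)) * u (k + 1) +
                  1 / ((n + 1 : ℕ) : ℝ) * u (k + 1)) := by
                field_simp
                ring
            _ ≤ _ := by
                have : 1 / ((n + 1 : ℕ) : ℝ) * u (k + 1) ≤ 1 / ((n + 1 : ℕ) : ℝ) :=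
                  mul_le_of_le_one_right (by positivity) (hu1 _)
                gcongr
      _ ≤ t * (X + 1) := by
          rw [← Finset.mul_sum, Finset.sum_add_distrib, Finset.sum_const, Finset.card_range,
            nsmul_eq_mul, mul_one_div_cancel hn0.ne']
          gcongr
  have h2 : ∑ k ∈ Finset.range K, |Real.sin ((n + 1 + k + 1 : ℕ) * t)| * u (n + 1 + k + 1) /
      ((n + 1 + k + 1 : ℕ) : ℝ) ^ 2 ≤ t := by
    calc _ ≤ ∑ k ∈ Finset.range K, 1 / ((n + 1 + k + 1 : ℕ) : ℝ) ^ 2 := by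
          refine Finset.sum_le_sum fun k _ => ?_
          gcongr
          exact mul_le_one₀ (Real.abs_sin_le_one _) (hu0 _) (hu1 _)
      _ ≤ 1 / ((n + 1 : ℕ) : ℝ) := by
          refine (sum_inv_sq_tail_le (n + 1) K (Nat.succ_pos n)).trans ?_
          have : 0 ≤ 1 / ((n + 1 + K : ℕ) : ℝ) := by positivity
          linarith
      _ ≤ t := by
          rw [div_le_iff₀ hn0]
          linarith
  linarith

theorem harmonic_le_log_add (n : ℕ) :
    (harmonic (n + 1) : ℝ) ≤ Real.log (n + 2) + Real.eulerMascheroniConstant := by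
  have := Real.eulerMascheroniSeq_lt_eulerMascheroniConstant (n + 1)
  rw [Real.eulerMascheroniSeq] at this
  push_cast at this
  rw [show (n : ℝ) + 1 + 1 = n + 2 by ring] at this
  linarith

/-- The bound from smoothing over `⌈2√q/π⌉` shifts and truncating at frequency `⌈√q/2⌉`. -/
theorem norm_sum_Icc_le {q : ℕ} [NeZero q] {χ : DirichletCharacter ℂ q} (hχ : χ ≠ 1)
    {M N : ℕ} (hMN : M ≤ N) {c : ℝ} (hc : 0 ≤ c)
    (hu : ∀ (h : ℕ) (x y : ℤ), ∃ u : ℕ → ℝ, (∀ k, 0 ≤ u k) ∧ (∀ k, u k ≤ 1) ∧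
      (∀ k : ℕ, ‖cosineSumDiff χ h x y k‖ ≤
        4 * √q * |Real.sin (k * (Real.pi * h / q))| * u k) ∧
      ∀ n : ℕ, ∑ k ∈ Finset.range (n + 1),
        (1 / ((k + 1 : ℕ) : ℝ) - 1 / ((n + 1 : ℕ) : ℝ)) * u (k + 1) ≤
          c * ((harmonic (n + 1) : ℝ) - 1 / 4)) :
    ‖∑ n ∈ Finset.Icc M N, χ (n : ZMod q)‖ ≤ √q / Real.pi + 1 / 2 + 2 * √q / Real.pi *
      (c * (Real.log q / 2 + 2 / √q + Real.eulerMascheroniConstant - 3 / 4) + 2) := by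
  have hq : (0 : ℝ) < q := by exact_mod_cast Nat.pos_of_ne_zero (NeZero.ne q)
  have hpi := Real.pi_pos
  have hs : 0 < √(q : ℝ) := Real.sqrt_pos.2 hq
  have hss : √(q : ℝ) * √q = q := Real.mul_self_sqrt hq.le
  set h := ⌈2 * √q / Real.pi⌉₊ with hh
  have h1 : 2 * √q / Real.pi ≤ h := Nat.le_ceil _
  have h2 : (h : ℝ) ≤ 2 * √q / Real.pi + 1 := (Nat.ceil_lt_add_one (by positivity)).le
  have h0 : 0 < h := Nat.ceil_pos.2 (by positivity)
  have h0' : (0 : ℝ) < h := by exact_mod_cast h0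
  obtain ⟨n, hn⟩ : ∃ n, ⌈√q / 2⌉₊ = n + 1 :=
    Nat.exists_eq_succ_of_ne_zero (Nat.ceil_pos.2 (by positivity)).ne'
  have hn1 : √q / 2 ≤ ((n + 1 : ℕ) : ℝ) := hn ▸ Nat.le_ceil _
  have hn2 : ((n + 1 : ℕ) : ℝ) ≤ √q / 2 + 1 :=
    hn ▸ (Nat.ceil_lt_add_one (by positivity)).le
  have hharm : (harmonic (n + 1) : ℝ) - 1 / 4 ≤
      Real.log q / 2 + 2 / √q + Real.eulerMascheroniConstant - 3 / 4 := by
    -- Factoring out `√q` produces `log q / 2`; the other factor is handled by `log z ≤ z - 1`,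
    -- giving `2 / √q - 1/2`.
    have e1 : ((n : ℝ) + 2) ≤ √q * (1 / 2 + 2 / √q) := by
      push_cast at hn2
      rw [mul_add, mul_div_cancel₀ _ hs.ne']
      linarith
    have e2 : Real.log (n + 2) ≤ Real.log q / 2 + Real.log (1 / 2 + 2 / √q) := by
      rw [← Real.log_sqrt hq.le, ← Real.log_mul hs.ne' (by positivity)]
      exact Real.log_le_log (by positivity) e1
    have e3 := Real.log_le_sub_one_of_pos (by positivity : 0 < 1 / 2 + 2 / √(q : ℝ))
    have e4 := harmonic_le_log_add n
    linarith
  set X := c * (Real.log q / 2 + 2 / √q + Real.eulerMascheroniConstant - 3 / 4) with hX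
  have hmain := norm_sum_Icc_le_of_cosineSumDiff hχ hMN h0
    (B := 4 * √q * (Real.pi * h / q * (X + 2))) (fun x y K => by
      obtain ⟨x, rfl⟩ := ZMod.intCast_surjective x
      obtain ⟨y, rfl⟩ := ZMod.intCast_surjective y
      obtain ⟨u, hu0, hu1, hu2, hu3⟩ := hu h x y
      have ht : 1 ≤ ((n + 1 : ℕ) : ℝ) * (Real.pi * h / q) := by
        rw [mul_div_assoc', le_div_iff₀ hq, one_mul]
        calc (q : ℝ) = √q / 2 * (Real.pi * (2 * √q / Real.pi)) := by
              rw [mul_div_cancel₀ _ hpi.ne']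
              linarith
          _ ≤ _ := by gcongr
      have := sum_abs_sin_mul_div_sq_le (by positivity) ht hu0 hu1
        ((hu3 n).trans (mul_le_mul_of_nonneg_left hharm hc)) K
      refine le_trans ?_ (mul_le_mul_of_nonneg_left this (by positivity))
      rw [Finset.mul_sum]
      refine Finset.sum_le_sum fun k _ => ?_
      rw [mul_div_assoc', ← mul_assoc]
      gcongr
      exact hu2 (k + 1))
  -- The shift count `h` cancels from the main term; it survives only in the smoothing error and in
  -- the requirement `R * t ≥ 1`.
  have e : q / (2 * Real.pi ^ 2 * h) * (4 * √q * (Real.pi * h / q * (X + 2))) =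
      2 * √q / Real.pi * (X + 2) := by
    field_simp
    ring
  rw [e] at hmain
  have : (h : ℝ) / 2 ≤ √q / Real.pi + 1 / 2 := by
    have : 2 * √q / Real.pi = 2 * (√q / Real.pi) := by ring
    linarith
  linarith

theorem norm_sum_Icc_le_of_even {q : ℕ} [NeZero q] {χ : DirichletCharacter ℂ q} (hχ : χ ≠ 1)
    (hp : χ.IsPrimitive) (he : χ.Even) {M N : ℕ} (hMN : M ≤ N) :
    ‖∑ n ∈ Finset.Icc M N, χ (n : ZMod q)‖ ≤ √q / Real.pi + 1 / 2 + 2 * √q / Real.pi *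
      (2 / Real.pi * (Real.log q / 2 + 2 / √q + Real.eulerMascheroniConstant - 3 / 4) + 2) :=
  norm_sum_Icc_le hχ hMN (by positivity) fun h x y =>
    ⟨fun k => |Real.sin (k * (Real.pi * (x - y) / q))|, fun _ => abs_nonneg _,
      fun _ => Real.abs_sin_le_one _, fun k => norm_cosineSumDiff_of_even_le hp he h k x y,
      fun n => sum_truncated_inv_mul_abs_sin_le _ n⟩

theorem norm_sum_Icc_le_of_odd {q : ℕ} [NeZero q] {χ : DirichletCharacter ℂ q} (hχ : χ ≠ 1)
    (hp : χ.IsPrimitive) (ho : χ.Odd) {M N : ℕ} (hMN : M ≤ N) :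
    ‖∑ n ∈ Finset.Icc M N, χ (n : ZMod q)‖ ≤ √q / Real.pi + 1 / 2 + 2 * √q / Real.pi *
      (1 / 2 * (Real.log q / 2 + 2 / √q + Real.eulerMascheroniConstant - 3 / 4) + 2) :=
  norm_sum_Icc_le hχ hMN (by positivity) fun h x y =>
    ⟨fun k => |Real.sin (k * (Real.pi * (x - y) / q))| *
        |Real.sin (k * (Real.pi * (x + y + h) / q))|, fun _ => by positivity,
      fun _ => mul_le_one₀ (Real.abs_sin_le_one _) (abs_nonneg _) (Real.abs_sin_le_one _),
      fun k => norm_cosineSumDiff_of_odd_le hp ho h k x y,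
      fun n => sum_truncated_inv_mul_abs_sin_mul_sin_le _ _ n⟩

/-! ### Numerical comparison with the stated bounds. -/

theorem le_C₀ : 74 ≤ C₀ := by
  have h1 : (3.14 : ℝ) < Real.pi := Real.pi_gt_d2
  have h2 : Real.pi ^ (5 / 2 : ℝ) = Real.pi ^ 2 * √Real.pi := by
    rw [Real.sqrt_eq_rpow, ← Real.rpow_natCast, ← Real.rpow_add Real.pi_pos]
    norm_num
  have h3 : (1.77 : ℝ) ≤ √Real.pi := Real.le_sqrt_of_sq_le (by norm_num; linarith)
  have h4 : (3.14 : ℝ) ^ 2 * 1.77 ≤ Real.pi ^ 2 * √Real.pi := by gcongr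
  rw [C₀, h2]
  norm_num at h4 ⊢
  linarith

/-- The threshold `15/4` is what the odd comparison needs when only `√q ≥ 1` and `π > 3` are used:
`(15/4 - 13/4) + 3/2 - 2 = 0`. -/
theorem le_log_two_mul_C₀_div_pi : 15 / 4 ≤ Real.log (2 * C₀ / Real.pi) := by
  have h1 : Real.pi < 3.15 := Real.pi_lt_d2
  have h2 := le_C₀
  have h3 : (46 : ℝ) ≤ 2 * C₀ / Real.pi := by
    rw [le_div_iff₀ Real.pi_pos]
    norm_num at h1
    linarith
  rw [Real.le_log_iff_exp_le (by linarith)]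
  refine le_trans ?_ h3
  -- Fourth powers clear the fractional exponent, leaving `exp 1 ^ 15 ≤ 46 ^ 4`.
  refine le_of_pow_le_pow_left₀ (n := 4) (by norm_num) (by norm_num) ?_
  rw [← Real.exp_nat_mul, show ((4 : ℕ) : ℝ) * (15 / 4) = (15 : ℕ) * 1 by norm_num,
    Real.exp_nat_mul]
  have h4 : Real.exp 1 ≤ 2.72 := Real.exp_one_lt_d9.le.trans (by norm_num)
  calc Real.exp 1 ^ 15 ≤ (2.72 : ℝ) ^ 15 := by gcongr
    _ ≤ _ := by norm_num

theorem le_log_C₀ : 15 / 4 ≤ Real.log C₀ := by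
  refine le_log_two_mul_C₀_div_pi.trans ?_
  have h := le_C₀
  have hpi := Real.pi_gt_three
  refine Real.log_le_log (div_pos (by linarith) Real.pi_pos) ?_
  rw [div_le_iff₀ Real.pi_pos]
  nlinarith

theorem sqrt_div_exp_sub_one_nonneg {c : ℝ} (hc : 0 ≤ c) (q : ℕ) :
    0 ≤ √(q : ℝ) / (Real.exp (c * √q / C₀) - 1) := by
  have h := le_C₀
  refine div_nonneg (Real.sqrt_nonneg _) (sub_nonneg.2 (Real.one_le_exp ?_))
  have := Real.sqrt_nonneg (q : ℝ)
  positivity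

theorem one_le_ψ₁ (q : ℕ) : 1 ≤ ψ₁ q := by
  have h := le_C₀
  have h1 := sqrt_div_exp_sub_one_nonneg zero_le_two q
  have h2 : 0 ≤ 24 / (Real.pi ^ 2 * C₀) := by positivity
  have h3 : 0 ≤ 8 / Real.pi ^ 2 * (√(q : ℝ) / (Real.exp (2 * √q / C₀) - 1)) :=
    mul_nonneg (by positivity) h1
  rw [ψ₁]
  linarith

theorem one_le_ψ₂ (q : ℕ) : 1 ≤ ψ₂ q := by
  have h := le_C₀
  have hpi := Real.pi_pos
  have h1 := sqrt_div_exp_sub_one_nonneg hpi.le q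
  have h2 : 0 ≤ 3 / C₀ := by positivity
  have h3 : 0 ≤ 2 / Real.pi * (√(q : ℝ) / (Real.exp (Real.pi * √q / C₀) - 1)) :=
    mul_nonneg (by positivity) h1
  rw [ψ₂]
  linarith

theorem even_bound_le {q : ℕ} (hq : 1 ≤ q) :
    √(q : ℝ) / Real.pi + 1 / 2 + 2 * √q / Real.pi *
      (2 / Real.pi * (Real.log q / 2 + 2 / √q + Real.eulerMascheroniConstant - 3 / 4) + 2) ≤
    2 / Real.pi ^ 2 * √q * Real.log q
      + 4 / Real.pi ^ 2 * √q * (1 + Real.eulerMascheroniConstant + Real.log C₀) + 1 := by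
  have hs : 1 ≤ √(q : ℝ) := Real.one_le_sqrt.2 (by exact_mod_cast hq)
  have hpi := Real.pi_pos
  have hpi3 := Real.pi_gt_three
  have hpi4 : Real.pi < 3.15 := Real.pi_lt_d2
  norm_num at hpi4
  have hl := le_log_C₀
  set s := √(q : ℝ)
  set l := Real.log C₀
  have hs0 : 0 < s := by linarith
  rw [← sub_nonneg]
  have e : 2 / Real.pi ^ 2 * s * Real.log q
      + 4 / Real.pi ^ 2 * s * (1 + Real.eulerMascheroniConstant + l) + 1 -
      (s / Real.pi + 1 / 2 + 2 * s / Real.pi *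
      (2 / Real.pi * (Real.log q / 2 + 2 / s + Real.eulerMascheroniConstant - 3 / 4) + 2)) =
      (4 * s * (7 / 4 + l) + Real.pi ^ 2 / 2 - 8 - 5 * s * Real.pi) / Real.pi ^ 2 := by
    field_simp
    ring
  rw [e]
  refine div_nonneg ?_ (by positivity)
  nlinarith [mul_le_mul_of_nonneg_left hl hs0.le, mul_le_mul_of_nonneg_left hpi4.le hs0.le]

theorem odd_bound_le {q : ℕ} (hq : 1 ≤ q) :
    √(q : ℝ) / Real.pi + 1 / 2 + 2 * √q / Real.pi *
      (1 / 2 * (Real.log q / 2 + 2 / √q + Real.eulerMascheroniConstant - 3 / 4) + 2) ≤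
    1 / (2 * Real.pi) * √q * Real.log q
      + 1 / Real.pi * √q
        * (1 + Real.eulerMascheroniConstant + Real.log (2 * C₀ / Real.pi)) + 1 := by
  have hs : 1 ≤ √(q : ℝ) := Real.one_le_sqrt.2 (by exact_mod_cast hq)
  have hpi := Real.pi_pos
  have hpi3 := Real.pi_gt_three
  have hl := le_log_two_mul_C₀_div_pi
  set s := √(q : ℝ)
  set l := Real.log (2 * C₀ / Real.pi)
  have hs0 : 0 < s := by linarith
  rw [← sub_nonneg]
  have e : 1 / (2 * Real.pi) * s * Real.log q
      + 1 / Real.pi * s * (1 + Real.eulerMascheroniConstant + l) + 1 -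
      (s / Real.pi + 1 / 2 + 2 * s / Real.pi *
      (1 / 2 * (Real.log q / 2 + 2 / s + Real.eulerMascheroniConstant - 3 / 4) + 2)) =
      (s * (l - 13 / 4) + Real.pi / 2 - 2) / Real.pi := by
    field_simp
    ring
  rw [e]
  refine div_nonneg ?_ hpi.le
  nlinarith [mul_le_mul_of_nonneg_left hl hs0.le]

theorem norm_sum_Icc_le_two_of_le_one (χ : DirichletCharacter ℂ 1) {M N : ℕ} (hN : N ≤ 1) :
    ‖∑ n ∈ Finset.Icc M N, χ (n : ZMod 1)‖ ≤ 2 := by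
  refine (norm_sum_le_of_le _ fun n _ => χ.norm_le_one _).trans ?_
  rw [Finset.sum_const, nsmul_eq_mul, mul_one, Nat.card_Icc]
  exact_mod_cast (by omega : N + 1 - M ≤ 2)

theorem theorem1 (q : ℕ) [NeZero q] (χ : DirichletCharacter ℂ q) (hχ : χ.IsPrimitive) :
    (χ.Even →
      maxCharSum χ ≤
        2 / Real.pi ^ 2 * Real.sqrt q * Real.log q
          + 4 / Real.pi ^ 2 * Real.sqrt q * (1 + Real.eulerMascheroniConstant + Real.log C₀)
          + ψ₁ q) ∧
    (χ.Odd →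
      maxCharSum χ ≤
        1 / (2 * Real.pi) * Real.sqrt q * Real.log q
          + 1 / Real.pi * Real.sqrt q
            * (1 + Real.eulerMascheroniConstant + Real.log (2 * C₀ / Real.pi))
          + ψ₂ q) := by
  have hψ₁ := one_le_ψ₁ q
  have hψ₂ := one_le_ψ₂ q
  have hq1 : 1 ≤ q := Nat.one_le_iff_ne_zero.2 (NeZero.ne q)
  -- For `q = 1` the character is trivial, so `∑ χ = 0` fails. An interval then has at most two
  -- terms, and the bound `2` is met by `1` from `ψ` and at least `1` from the middle term.
  rcases eq_or_ne q 1 with rfl | hq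
  · have hγ := Real.one_half_lt_eulerMascheroniConstant
    have hpi := Real.pi_pos
    have hpi4 : Real.pi < 3.15 := Real.pi_lt_d2
    norm_num at hpi4
    have hmax : maxCharSum χ ≤ 2 := Finset.sup'_le _ _ fun p hp => by
      simp only [charSumRanges, Finset.mem_filter, Finset.mem_product, Finset.mem_range] at hp
      exact norm_sum_Icc_le_two_of_le_one χ (by omega)
    simp only [Nat.cast_one, Real.sqrt_one, Real.log_one, mul_one, mul_zero, zero_add]
    refine ⟨fun _ => hmax.trans ?_, fun _ => hmax.trans ?_⟩
    · have hl := le_log_C₀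
      have : 1 ≤ 4 / Real.pi ^ 2 * (1 + Real.eulerMascheroniConstant + Real.log C₀) := by
        rw [div_mul_eq_mul_div, le_div_iff₀ (by positivity)]
        nlinarith
      linarith
    · have hl := le_log_two_mul_C₀_div_pi
      have : 1 ≤ 1 / Real.pi *
          (1 + Real.eulerMascheroniConstant + Real.log (2 * C₀ / Real.pi)) := by
        rw [div_mul_eq_mul_div, le_div_iff₀ hpi]
        linarith
      linarith
  · have hne : χ ≠ 1 := by
      rintro rfl
      rw [DirichletCharacter.isPrimitive_def, DirichletCharacter.conductor_one] at hχ
      exact hq hχ.symm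
    refine ⟨fun he => Finset.sup'_le _ _ fun p hp => ?_,
      fun ho => Finset.sup'_le _ _ fun p hp => ?_⟩
    · have hlt := (Finset.mem_filter.1 hp).2
      have h1 := norm_sum_Icc_le_of_even hne hχ he hlt.le
      have h2 := even_bound_le hq1
      linarith
    · have hlt := (Finset.mem_filter.1 hp).2
      have h1 := norm_sum_Icc_le_of_odd hne hχ ho hlt.le
      have h2 := odd_bound_le hq1
      linarith
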